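/- Let $\mathbb{R}\langle x,x^*\rangle$ be the free real $*$-algebra on $x=(x_1,\dots,x_g)$ and $x^*=(x_1^*,\dots,x_g^*)$, and $\mathbb{R}\langle x,x^*\rangle_d$ its polynomials of degree at most $d$. A matrix polynomial $p=\sum_w A_w\otimes w\in\mathbb{R}^{\mu\times\ell}\langle x,x^*\rangle$ is evaluated at a $g$-tuple $X$ of real $N\times N$ matrices by $p(X)=\sum_w A_w\otimes w(X)$, where $x_i^*$ is replaced by $X_i^{*}$, the transpose. A linear pencil is an $L=L^*\in\mathbb{R}^{\nu\times\nu}\langle x,x^*\rangle$ of degree at most $1$; put $\mathcal D_L(N)=\{X\in(\mathbb{R}^{N\times N})^g: L(X)\succeq 0\}$ and $\mathcal D_L=\bigcup_N\mathcal D_L(N)$. Let $\mathfrak C\subseteq\mathbb{R}^{1\times\ell}\langle x,x^*\rangle$ be a full, finite right chip space: a finite-dimensional subspace spanned by monomials $e_i\otimes w$ such that $e_i\otimes w_1w_2\in\mathfrak C$ implies $e_i\otimes w_2\in\mathfrak C$. A left $\mathbb{R}\langle x,x^*\rangle$-submodule $J$ of $\mathbb{R}^{1\times\ell}\langle x,x^*\rangle$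 is called $(L,\mathfrak C)$-real if, whenever finitely many $p_i\in\mathfrak C$ and $q_j\in\mathbb{R}^{\nu\times1}\mathfrak C$ satisfy $\sum_i p_i^*p_i+\sum_j q_j^*Lq_j\in\mathbb{R}^{\ell\times1}J+J^*\mathbb{R}^{1\times\ell}$, all $p_i\in J$ and all $Lq_j\in\mathbb{R}^{\nu\times1}J$; it is strongly $(L,\mathfrak C)$-real if under the same assumption all $p_i\in J$ and all $q_j\in\mathbb{R}^{\nu\times1}J$. Let $R$ and $R_+$ be the $(L,\mathfrak C)$-real radical and the strong $(L,\mathfrak C)$-real radical of $\{0\}$, that is, the intersection of all $(L,\mathfrak C)$-real, respectively strongly $(L,\mathfrak C)$-real, left submodules, and set $$n=\dim\mathfrak C-\dim(R\cap\mathfrak C),\qquad n_+=\dim\mathfrak C-\dim(R_+\cap\mathfrak C).$$ Let $L$ be a linear pencil and let $p=p^*\in\mathfrak C^*\,\mathbb{R}\langle x,x^*\rangle_1\,\mathfrak C$ (the span of all $c^*rd$ with $c,d\in\mathfrak C$ and $r\in\mathbb{R}\langle x,x^*\rangle_1$). No boundedness or interior assumption on $\mathcal D_L$ is made. Then: 1.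 If $n_+\ge1$, then $p(X)\succ0$ for all $X\in\mathcal D_L$ if and only if $p(X)\succ0$ for all $X\in\mathcal D_L(n_+)$. If $n\ge1$ (whether or not $n_+\ge1$), then $p(X)\succ0$ for all $X\in\mathcal D_L$ if and only if $p(X)\succ0$ for all $X\in\mathcal D_L(n)$. 2. $p(X)\succeq0$ for all $X\in\mathcal D_L$ if and only if $p(X)\succeq0$ for all $X\in\mathcal D_L(n)$ (for $n=0$ the condition on $\mathcal D_L(n)$ is void). -/

import Mathlib

noncomputable section

namespace FreePencil

/-- Words in the `2g` free letters `x_1, …, x_g` (the letters `Sum.inl i`) and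
`x_1^*, …, x_g^*` (the letters `Sum.inr i`). -/
abbrev NCWord (g : ℕ) : Type := FreeMonoid (Fin g ⊕ Fin g)

/-- The free algebra `ℝ⟨x, x^*⟩` of noncommutative polynomials. -/
abbrev NCPoly (g : ℕ) : Type := MonoidAlgebra ℝ (NCWord g)

/-- The involution of `ℝ⟨x, x^*⟩` as an algebra homomorphism to the opposite algebra:
it is linear, reverses products and exchanges `x_i` and `x_i^*`. -/
def adjHom (g : ℕ) : NCPoly g →ₐ[ℝ] (NCPoly g)ᵐᵒᵖ :=
  MonoidAlgebra.lift ℝ (NCPoly g)ᵐᵒᵖ (NCWord g)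
    (FreeMonoid.lift fun s => MulOpposite.op (MonoidAlgebra.single (FreeMonoid.of s.swap) 1))

theorem adjHom_comp (g : ℕ) :
    ((AlgHom.op (adjHom g)).comp (adjHom g)) =
      (AlgEquiv.opOp ℝ (NCPoly g) : NCPoly g →ₐ[ℝ] (NCPoly g)ᵐᵒᵖᵐᵒᵖ) := by
  apply MonoidAlgebra.algHom_ext'
  · apply FreeMonoid.hom_eq
    intro s
    simp [adjHom]
  · exact Subsingleton.elim _ _

instance instStarRingNCPoly (g : ℕ) : StarRing (NCPoly g) where
  star p := (adjHom g p).unop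
  star_involutive p := by
    have h := DFunLike.congr_fun (adjHom_comp g) p
    exact congrArg (fun z => z.unop.unop) h
  star_mul p q := by simp
  star_add p q := by simp

/-- `ℝ⟨x, x^*⟩_d`: the polynomials of degree at most `d`. -/
def degLE (g d : ℕ) : Submodule ℝ (NCPoly g) :=
  Submodule.span ℝ {m | ∃ w : NCWord g, w.length ≤ d ∧ m = MonoidAlgebra.single w 1}

/-- The value `p(X)` of `p ∈ ℝ⟨x, x^*⟩` at a tuple `X` of real `N × N` matrices: `x_i` is replaced
by `X_i`, `x_i^*` by the transpose of `X_i`, and the empty word by the identity. -/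
def eval {g N : ℕ} (X : Fin g → Matrix (Fin N) (Fin N) ℝ) :
    NCPoly g →ₐ[ℝ] Matrix (Fin N) (Fin N) ℝ :=
  MonoidAlgebra.lift ℝ (Matrix (Fin N) (Fin N) ℝ) (NCWord g)
    (FreeMonoid.lift (Sum.elim X fun i => (X i).transpose))

/-- The value `p(X) = ∑_w A_w ⊗ w(X)` (Kronecker products) of a matrix polynomial
`p = ∑_w A_w ⊗ w`; its `(i, j)` block is `p_{ij}(X)`. -/
def evalMat {g N μ ℓ : ℕ} (p : Matrix (Fin μ) (Fin ℓ) (NCPoly g))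
    (X : Fin g → Matrix (Fin N) (Fin N) ℝ) : Matrix (Fin μ × Fin N) (Fin ℓ × Fin N) ℝ :=
  Matrix.of fun a b => eval X (p a.1 b.1) a.2 b.2

/-- A linear pencil: a symmetric square matrix polynomial of degree at most one. -/
def IsLinearPencil {g ν : ℕ} (L : Matrix (Fin ν) (Fin ν) (NCPoly g)) : Prop :=
  L.IsHermitian ∧ ∀ i j, L i j ∈ degLE g 1

/-- The positivity domain `𝒟_L(N)` of `L` at size `N`. -/
def posDomain {g ν : ℕ} (L : Matrix (Fin ν) (Fin ν) (NCPoly g)) (N : ℕ) :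
    Set (Fin g → Matrix (Fin N) (Fin N) ℝ) :=
  {X | (evalMat L X).PosSemidef}

/-- `p ⪰ 0` on `𝒟_L(N)`. -/
def NonnegOn {g ν ℓ : ℕ} (p : Matrix (Fin ℓ) (Fin ℓ) (NCPoly g))
    (L : Matrix (Fin ν) (Fin ν) (NCPoly g)) (N : ℕ) : Prop :=
  ∀ X ∈ posDomain L N, (evalMat p X).PosSemidef

/-- `p ≻ 0` on `𝒟_L(N)`. -/
def PosOn {g ν ℓ : ℕ} (p : Matrix (Fin ℓ) (Fin ℓ) (NCPoly g))
    (L : Matrix (Fin ν) (Fin ν) (NCPoly g)) (N : ℕ) : Prop :=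
  ∀ X ∈ posDomain L N, (evalMat p X).PosDef

/-- The space `ℝ^{1 × ℓ}⟨x, x^*⟩` of rows of polynomials. It is a left `ℝ⟨x, x^*⟩`-module through
left multiplication of every entry, and its submodules over `NCPoly g` are the left modules. -/
abbrev Row (g ℓ : ℕ) : Type := Fin ℓ → NCPoly g

/-- The monomial `e_i ⊗ w`. -/
def monomial {g ℓ : ℕ} (i : Fin ℓ) (w : NCWord g) : Row g ℓ :=
  Pi.single i (MonoidAlgebra.single w 1)

/-- Right chip spaces: spanned by monomials, and containing `e_i ⊗ w₂w₃` whenever they contain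
`e_i ⊗ w₁w₂w₃` and `e_i ⊗ w₃`. -/
def IsRightChipSpace {g ℓ : ℕ} (C : Submodule ℝ (Row g ℓ)) : Prop :=
  (∃ S : Set (Fin ℓ × NCWord g), C = Submodule.span ℝ ((fun m => monomial m.1 m.2) '' S)) ∧
  ∀ (i : Fin ℓ) (w₁ w₂ w₃ : NCWord g),
    monomial i (w₁ * w₂ * w₃) ∈ C → monomial i w₃ ∈ C → monomial i (w₂ * w₃) ∈ C

/-- A right chip space is full if with `e_i ⊗ w` it contains all its right chips. -/
def IsFull {g ℓ : ℕ} (C : Submodule ℝ (Row g ℓ)) : Prop :=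
  ∀ (i : Fin ℓ) (w₁ w₂ : NCWord g), monomial i (w₁ * w₂) ∈ C → monomial i w₂ ∈ C

/-- `C^* ℝ⟨x, x^*⟩_1 C`: the span of all products `c^* r d` with `c, d ∈ C`, `deg r ≤ 1`. -/
def chipProducts {g ℓ : ℕ} (C : Submodule ℝ (Row g ℓ)) :
    Submodule ℝ (Matrix (Fin ℓ) (Fin ℓ) (NCPoly g)) :=
  Submodule.span ℝ {M | ∃ c ∈ C, ∃ d ∈ C, ∃ r ∈ degLE g 1, M = Matrix.vecMulVec (star c) (r • d)}

/-- `ℝ^{ℓ × 1} J + J^* ℝ^{1 × ℓ}`: sums of a matrix with rows in `J` and the adjoint of another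
such matrix. -/
def rowsAddAdj {g ℓ : ℕ} (J : Submodule (NCPoly g) (Row g ℓ)) :
    Set (Matrix (Fin ℓ) (Fin ℓ) (NCPoly g)) :=
  {M | ∃ A B : Matrix (Fin ℓ) (Fin ℓ) (NCPoly g),
    (∀ k, A k ∈ J) ∧ (∀ k, B k ∈ J) ∧ M = A + B.conjTranspose}

/-- The sum `∑ p_i^* p_i + ∑ q_j^* L q_j`. -/
def squaresSum {g ν ℓ s t : ℕ} (L : Matrix (Fin ν) (Fin ν) (NCPoly g))
    (p : Fin s → Row g ℓ) (q : Fin t → Matrix (Fin ν) (Fin ℓ) (NCPoly g)) :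
    Matrix (Fin ℓ) (Fin ℓ) (NCPoly g) :=
  ∑ i, Matrix.vecMulVec (star (p i)) (p i) + ∑ j, (q j).conjTranspose * L * q j

/-- The left module `J` is `(L, C)`-real. -/
def IsReal {g ν ℓ : ℕ} (L : Matrix (Fin ν) (Fin ν) (NCPoly g)) (C : Submodule ℝ (Row g ℓ))
    (J : Submodule (NCPoly g) (Row g ℓ)) : Prop :=
  ∀ (s t : ℕ) (p : Fin s → Row g ℓ) (q : Fin t → Matrix (Fin ν) (Fin ℓ) (NCPoly g)),
    (∀ i, p i ∈ C) → (∀ j k, q j k ∈ C) → squaresSum L p q ∈ rowsAddAdj J →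
      (∀ i, p i ∈ J) ∧ ∀ j k, (L * q j) k ∈ J

/-- The left module `J` is strongly `(L, C)`-real. -/
def IsStronglyReal {g ν ℓ : ℕ} (L : Matrix (Fin ν) (Fin ν) (NCPoly g))
    (C : Submodule ℝ (Row g ℓ)) (J : Submodule (NCPoly g) (Row g ℓ)) : Prop :=
  ∀ (s t : ℕ) (p : Fin s → Row g ℓ) (q : Fin t → Matrix (Fin ν) (Fin ℓ) (NCPoly g)),
    (∀ i, p i ∈ C) → (∀ j k, q j k ∈ C) → squaresSum L p q ∈ rowsAddAdj J →
      (∀ i, p i ∈ J) ∧ ∀ j k, q j k ∈ J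

/-- The `(L, C)`-real radical of the left module `I`. -/
def realRadical {g ν ℓ : ℕ} (L : Matrix (Fin ν) (Fin ν) (NCPoly g)) (C : Submodule ℝ (Row g ℓ))
    (I : Submodule (NCPoly g) (Row g ℓ)) : Submodule (NCPoly g) (Row g ℓ) :=
  sInf {J | I ≤ J ∧ IsReal L C J}

/-- The strong `(L, C)`-real radical of the left module `I`. -/
def strongRealRadical {g ν ℓ : ℕ} (L : Matrix (Fin ν) (Fin ν) (NCPoly g))
    (C : Submodule ℝ (Row g ℓ)) (I : Submodule (NCPoly g) (Row g ℓ)) :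
    Submodule (NCPoly g) (Row g ℓ) :=
  sInf {J | I ≤ J ∧ IsStronglyReal L C J}

/-- `n = dim C - dim (J ∩ C)` for `J` the `(L, C)`-real radical of `{0}`. -/
def testSize {g ν ℓ : ℕ} (L : Matrix (Fin ν) (Fin ν) (NCPoly g))
    (C : Submodule ℝ (Row g ℓ)) : ℕ :=
  Module.finrank ℝ C -
    Module.finrank ℝ ((realRadical L C ⊥).restrictScalars ℝ ⊓ C : Submodule ℝ (Row g ℓ))

/-- `n_+ = dim C - dim (J ∩ C)` for `J` the strong `(L, C)`-real radical of `{0}`. -/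
def strongTestSize {g ν ℓ : ℕ} (L : Matrix (Fin ν) (Fin ν) (NCPoly g))
    (C : Submodule ℝ (Row g ℓ)) : ℕ :=
  Module.finrank ℝ C -
    Module.finrank ℝ ((strongRealRadical L C ⊥).restrictScalars ℝ ⊓ C : Submodule ℝ (Row g ℓ))

end FreePencil

end

noncomputable section

namespace FreePencil

open Matrix

/-! Fix `X` in the positivity domain and a vector `v`, and let V be the space of all `c(X) v` with
`c ∈ C`. The rows vanishing at `(X, v)` form a left module. It is real since `L(X) ⪰ 0`, so it
contains the real radical, and dim V ≤ n.

Compress `X` to V. As the pencil has degree one, the compression stays in the domain; a matrix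
convex combination fills it up to size exactly n (`exists_compression`). Fullness lets one peel
letters off a word from the left without leaving `C`, so rows of `C` commute with the compression
(`rowEval_compression`). The form of `c^* r d` is `⟨c(X) v, r(X) d(X) v⟩`, which therefore keeps its
value (`quad_compression`), and positivity at size n gives positivity at every size.

For n_+ the same bound on dim V is needed on the whole domain, although the vanishing module is
known to be strongly real only where `L(X) ≻ 0`. A theorem of the alternative
(`exists_contraction_or_exists_pos`) decides. If `L` is strictly positive at some real point, every
`X` in the domain is a limit of strictly feasible tuples and continuity applies. Otherwise some
density matrix contracts `L` to a constant `a ≤ 0`; this forces `C` into every strongly real module,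
and n_+ = 0. -/

/-! ### The involution and its compatibility with evaluation -/

theorem star_single_of {g : ℕ} (s : Fin g ⊕ Fin g) :
    star (MonoidAlgebra.single (FreeMonoid.of s) 1 : NCPoly g) =
      MonoidAlgebra.single (FreeMonoid.of s.swap) 1 := by
  change (adjHom g _).unop = _
  simp [adjHom]

theorem star_algebraMap {g : ℕ} (a : ℝ) :
    star (algebraMap ℝ (NCPoly g) a) = algebraMap ℝ (NCPoly g) a := by
  change (adjHom g _).unop = _
  rw [AlgHom.commutes]
  rfl

theorem star_real_smul {g : ℕ} (a : ℝ) (p : NCPoly g) : star (a • p) = a • star p := by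
  rw [Algebra.smul_def, star_mul, star_algebraMap, Algebra.smul_def, Algebra.commutes]

theorem eval_single_of {g N : ℕ} (X : Fin g → Matrix (Fin N) (Fin N) ℝ) (s : Fin g ⊕ Fin g) :
    eval X (MonoidAlgebra.single (FreeMonoid.of s) 1) = Sum.elim X (fun i => (X i)ᵀ) s := by
  simp [eval]

theorem algHom_ext_letters {g : ℕ} {A : Type*} [Semiring A] [Algebra ℝ A]
    {φ ψ : NCPoly g →ₐ[ℝ] A}
    (h : ∀ s, φ (MonoidAlgebra.single (FreeMonoid.of s) 1) =
      ψ (MonoidAlgebra.single (FreeMonoid.of s) 1)) : φ = ψ := by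
  apply MonoidAlgebra.algHom_ext'
  · apply FreeMonoid.hom_eq
    intro s
    simpa using h s
  · exact Subsingleton.elim _ _

/-- Both sides are algebra homomorphisms into the opposite matrix algebra, so the letters decide. -/
theorem eval_star {g N : ℕ} (X : Fin g → Matrix (Fin N) (Fin N) ℝ) (p : NCPoly g) :
    eval X (star p) = (eval X p)ᵀ := by
  have h : (AlgHom.op (eval X)).comp (adjHom g) =
      (Matrix.transposeAlgEquiv (Fin N) ℝ ℝ : _ →ₐ[ℝ] _).comp (eval X) := by
    apply algHom_ext_letters
    intro s
    have h1 : adjHom g (MonoidAlgebra.single (FreeMonoid.of s) 1) =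
        MulOpposite.op (MonoidAlgebra.single (FreeMonoid.of s.swap) 1) := by
      simp [adjHom]
    rw [AlgHom.comp_apply, AlgHom.comp_apply, h1, eval_single_of]
    simp only [AlgHom.op_apply_apply, MulOpposite.unop_op, eval_single_of]
    rcases s with i | i <;> simp
  exact congrArg MulOpposite.unop (DFunLike.congr_fun h p)

/-! ### Quadratic forms and the vanishing modules -/

/-- The vector `c(X) v` for a row `c` of polynomials. -/
def rowEval {g ℓ N : ℕ} (X : Fin g → Matrix (Fin N) (Fin N) ℝ) (v : Fin ℓ → Fin N → ℝ) :
    Row g ℓ →ₗ[ℝ] (Fin N → ℝ) where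
  toFun c := ∑ i, eval X (c i) *ᵥ v i
  map_add' c d := by simp [Matrix.add_mulVec, Finset.sum_add_distrib]
  map_smul' a c := by simp [Matrix.smul_mulVec, Finset.smul_sum]

theorem rowEval_apply {g ℓ N : ℕ} (X : Fin g → Matrix (Fin N) (Fin N) ℝ) (v : Fin ℓ → Fin N → ℝ)
    (c : Row g ℓ) : rowEval X v c = ∑ i, eval X (c i) *ᵥ v i := rfl

theorem rowEval_poly_smul {g ℓ N : ℕ} (X : Fin g → Matrix (Fin N) (Fin N) ℝ)
    (v : Fin ℓ → Fin N → ℝ) (r : NCPoly g) (c : Row g ℓ) :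
    rowEval X v (r • c) = eval X r *ᵥ rowEval X v c := by
  simp [rowEval_apply, Matrix.mulVec_sum]

theorem rowEval_monomial {g ℓ N : ℕ} (X : Fin g → Matrix (Fin N) (Fin N) ℝ)
    (v : Fin ℓ → Fin N → ℝ) (i : Fin ℓ) (w : NCWord g) :
    rowEval X v (monomial i w) = eval X (MonoidAlgebra.single w 1) *ᵥ v i := by
  rw [rowEval_apply, Finset.sum_eq_single i]
  · simp [monomial]
  · intro j _ hj
    simp [monomial, Pi.single_eq_of_ne hj]
  · simp

theorem poly_smul_monomial {g ℓ : ℕ} (i : Fin ℓ) (w w' : NCWord g) :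
    (MonoidAlgebra.single w 1 : NCPoly g) • (monomial i w' : Row g ℓ) = monomial i (w * w') := by
  rw [monomial, ← Pi.single_smul']
  simp [monomial]

/-- The left module of the rows which vanish at `(X, v)`. -/
def vanishing {g ℓ N : ℕ} (X : Fin g → Matrix (Fin N) (Fin N) ℝ) (v : Fin ℓ → Fin N → ℝ) :
    Submodule (NCPoly g) (Row g ℓ) where
  carrier := {c | rowEval X v c = 0}
  add_mem' {a b} ha hb := by
    simp only [Set.mem_ofPred_eq] at *
    rw [map_add, ha, hb, add_zero]
  zero_mem' := map_zero _
  smul_mem' r c hc := by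
    simp only [Set.mem_ofPred_eq] at *
    rw [rowEval_poly_smul, hc, Matrix.mulVec_zero]

theorem mem_vanishing {g ℓ N : ℕ} {X : Fin g → Matrix (Fin N) (Fin N) ℝ}
    {v : Fin ℓ → Fin N → ℝ} {c : Row g ℓ} : c ∈ vanishing X v ↔ rowEval X v c = 0 := Iff.rfl

/-- The quadratic form `⟨p(X) v, v⟩`. -/
def quad {g ℓ N : ℕ} (X : Fin g → Matrix (Fin N) (Fin N) ℝ) (v : Fin ℓ → Fin N → ℝ) :
    Matrix (Fin ℓ) (Fin ℓ) (NCPoly g) →ₗ[ℝ] ℝ where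
  toFun p := ∑ i, v i ⬝ᵥ rowEval X v (p i)
  map_add' p q := by
    rw [← Finset.sum_add_distrib]
    refine Finset.sum_congr rfl fun i _ => ?_
    rw [← dotProduct_add, ← map_add]; rfl
  map_smul' a p := by
    rw [RingHom.id_apply, Finset.smul_sum]
    refine Finset.sum_congr rfl fun i _ => ?_
    rw [← dotProduct_smul, ← map_smul]; rfl

theorem quad_apply {g ℓ N : ℕ} (X : Fin g → Matrix (Fin N) (Fin N) ℝ) (v : Fin ℓ → Fin N → ℝ)
    (p : Matrix (Fin ℓ) (Fin ℓ) (NCPoly g)) : quad X v p = ∑ i, v i ⬝ᵥ rowEval X v (p i) := rfl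

theorem evalMat_mulVec {g μ ℓ N : ℕ} (X : Fin g → Matrix (Fin N) (Fin N) ℝ)
    (p : Matrix (Fin μ) (Fin ℓ) (NCPoly g)) (y : Fin ℓ × Fin N → ℝ) (k : Fin μ) (a : Fin N) :
    (evalMat p X *ᵥ y) (k, a) = rowEval X (Function.curry y) (p k) a := by
  simp [evalMat, Matrix.mulVec, rowEval_apply, dotProduct, Fintype.sum_prod_type, Function.curry]

theorem dotProduct_evalMat {g ℓ N : ℕ} (X : Fin g → Matrix (Fin N) (Fin N) ℝ)
    (p : Matrix (Fin ℓ) (Fin ℓ) (NCPoly g)) (y : Fin ℓ × Fin N → ℝ) :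
    y ⬝ᵥ (evalMat p X *ᵥ y) = quad X (Function.curry y) p := by
  simp [quad_apply, dotProduct, Fintype.sum_prod_type, evalMat_mulVec, Function.curry]

theorem evalMat_isHermitian {g ℓ N : ℕ} (X : Fin g → Matrix (Fin N) (Fin N) ℝ)
    {p : Matrix (Fin ℓ) (Fin ℓ) (NCPoly g)} (hp : p.IsHermitian) :
    (evalMat p X).IsHermitian := by
  ext ⟨i, a⟩ ⟨j, b⟩
  have h := congrArg (eval X) (hp.apply i j)
  rw [eval_star] at h
  simpa [evalMat] using congrFun (congrFun h a) b

theorem posSemidef_evalMat_iff {g ℓ N : ℕ} (X : Fin g → Matrix (Fin N) (Fin N) ℝ)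
    {p : Matrix (Fin ℓ) (Fin ℓ) (NCPoly g)} (hp : p.IsHermitian) :
    (evalMat p X).PosSemidef ↔ ∀ v, 0 ≤ quad X v p := by
  constructor
  · intro h v
    simpa [dotProduct_evalMat] using h.dotProduct_mulVec_nonneg (Function.uncurry v)
  · intro h
    refine .of_dotProduct_mulVec_nonneg (evalMat_isHermitian X hp) fun y => ?_
    simpa [dotProduct_evalMat] using h (Function.curry y)

theorem posDef_evalMat_iff {g ℓ N : ℕ} (X : Fin g → Matrix (Fin N) (Fin N) ℝ)
    {p : Matrix (Fin ℓ) (Fin ℓ) (NCPoly g)} (hp : p.IsHermitian) :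
    (evalMat p X).PosDef ↔ ∀ v, v ≠ 0 → 0 < quad X v p := by
  constructor
  · intro h v hv
    have hv' : Function.uncurry v ≠ 0 := fun h0 => hv (by
      ext i a
      exact congrFun h0 (i, a))
    simpa [dotProduct_evalMat] using h.dotProduct_mulVec_pos hv'
  · intro h
    refine .of_dotProduct_mulVec_pos (evalMat_isHermitian X hp) fun y hy => ?_
    have hy' : Function.curry y ≠ 0 := fun h0 => hy (by
      ext ⟨i, a⟩
      exact congrFun (congrFun h0 i) a)
    simpa [dotProduct_evalMat] using h (Function.curry y) hy'

theorem quad_vecMulVec {g ℓ N : ℕ} (X : Fin g → Matrix (Fin N) (Fin N) ℝ) (v : Fin ℓ → Fin N → ℝ)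
    (c d : Row g ℓ) :
    quad X v (vecMulVec (star c) d) = rowEval X v c ⬝ᵥ rowEval X v d := by
  have h (i : Fin ℓ) : vecMulVec (star c) d i = star (c i) • d := by
    ext j
    simp [vecMulVec_apply]
  rw [quad_apply, rowEval_apply X v c, sum_dotProduct]
  refine Finset.sum_congr rfl fun i _ => ?_
  rw [h, rowEval_poly_smul, eval_star, dotProduct_mulVec, vecMul_transpose]

theorem quad_conjTranspose {g ℓ N : ℕ} (X : Fin g → Matrix (Fin N) (Fin N) ℝ)
    (v : Fin ℓ → Fin N → ℝ) (B : Matrix (Fin ℓ) (Fin ℓ) (NCPoly g)) :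
    quad X v Bᴴ = quad X v B := by
  simp only [quad_apply, rowEval_apply, dotProduct_sum]
  rw [Finset.sum_comm]
  refine Finset.sum_congr rfl fun i _ => Finset.sum_congr rfl fun j _ => ?_
  rw [conjTranspose_apply, eval_star, dotProduct_mulVec, vecMul_transpose, dotProduct_comm]

theorem rowEval_mul_row {g μ ν ℓ N : ℕ} (X : Fin g → Matrix (Fin N) (Fin N) ℝ)
    (v : Fin ℓ → Fin N → ℝ) (L : Matrix (Fin μ) (Fin ν) (NCPoly g))
    (q : Matrix (Fin ν) (Fin ℓ) (NCPoly g)) (k : Fin μ) :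
    rowEval X v ((L * q) k) = rowEval X (fun k' => rowEval X v (q k')) (L k) := by
  have h : (L * q) k = ∑ k', L k k' • q k' := by
    ext j
    simp [Matrix.mul_apply]
  rw [h, map_sum, rowEval_apply X _ (L k)]
  exact Finset.sum_congr rfl fun k' _ => rowEval_poly_smul X v _ _

theorem quad_conjTranspose_mul_mul {g ν ℓ N : ℕ} (X : Fin g → Matrix (Fin N) (Fin N) ℝ)
    (v : Fin ℓ → Fin N → ℝ) (L : Matrix (Fin ν) (Fin ν) (NCPoly g))
    (q : Matrix (Fin ν) (Fin ℓ) (NCPoly g)) :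
    quad X v (qᴴ * L * q) = quad X (fun k => rowEval X v (q k)) L := by
  have h : qᴴ * L * q = ∑ k, vecMulVec (star (q k)) ((L * q) k) := by
    rw [Matrix.mul_assoc]
    ext i j
    rw [Matrix.mul_apply, Matrix.sum_apply]
    simp [vecMulVec_apply]
  rw [h, map_sum, quad_apply]
  exact Finset.sum_congr rfl fun k _ => by rw [quad_vecMulVec, rowEval_mul_row]

theorem quad_eq_zero_of_mem_rowsAddAdj {g ℓ N : ℕ} (X : Fin g → Matrix (Fin N) (Fin N) ℝ)
    (v : Fin ℓ → Fin N → ℝ) {M : Matrix (Fin ℓ) (Fin ℓ) (NCPoly g)}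
    (hM : M ∈ rowsAddAdj (vanishing X v)) : quad X v M = 0 := by
  obtain ⟨A, B, hA, hB, rfl⟩ := hM
  have hz (A : Matrix (Fin ℓ) (Fin ℓ) (NCPoly g)) (hA : ∀ k, A k ∈ vanishing X v) :
      quad X v A = 0 := by
    rw [quad_apply]
    exact Finset.sum_eq_zero fun i _ => by rw [mem_vanishing.1 (hA i), dotProduct_zero]
  rw [map_add, quad_conjTranspose, hz A hA, hz B hB, add_zero]

/-- The form at `v` kills the right-hand side of the realness condition and is nonnegative on each
summand, so each summand contributes zero. -/
theorem vanishing_of_squaresSum {g ν ℓ N s t : ℕ} {X : Fin g → Matrix (Fin N) (Fin N) ℝ}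
    {v : Fin ℓ → Fin N → ℝ} {L : Matrix (Fin ν) (Fin ν) (NCPoly g)} (hX : X ∈ posDomain L N)
    (hL : L.IsHermitian)
    {p : Fin s → Row g ℓ} {q : Fin t → Matrix (Fin ν) (Fin ℓ) (NCPoly g)}
    (h : squaresSum L p q ∈ rowsAddAdj (vanishing X v)) :
    (∀ i, rowEval X v (p i) = 0) ∧ ∀ j, quad X (fun k => rowEval X v (q j k)) L = 0 := by
  have h0 := quad_eq_zero_of_mem_rowsAddAdj X v h
  simp only [squaresSum, map_add, map_sum, quad_vecMulVec, quad_conjTranspose_mul_mul] at h0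
  have hp (i) : 0 ≤ rowEval X v (p i) ⬝ᵥ rowEval X v (p i) := by
    simpa using dotProduct_star_self_nonneg (rowEval X v (p i))
  have hq (j) : 0 ≤ quad X (fun k => rowEval X v (q j k)) L :=
    (posSemidef_evalMat_iff X hL).1 hX _
  rw [add_eq_zero_iff_of_nonneg (Finset.sum_nonneg fun i _ => hp i)
    (Finset.sum_nonneg fun j _ => hq j)] at h0
  refine ⟨fun i => ?_, fun j => ?_⟩
  · exact dotProduct_self_eq_zero.1
      ((Finset.sum_eq_zero_iff_of_nonneg fun i _ => hp i).1 h0.1 i (Finset.mem_univ i))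
  · exact (Finset.sum_eq_zero_iff_of_nonneg fun j _ => hq j).1 h0.2 j (Finset.mem_univ j)

theorem isReal_vanishing {g ν ℓ N : ℕ} {X : Fin g → Matrix (Fin N) (Fin N) ℝ}
    (v : Fin ℓ → Fin N → ℝ) {L : Matrix (Fin ν) (Fin ν) (NCPoly g)} (hX : X ∈ posDomain L N)
    (hL : L.IsHermitian) (C : Submodule ℝ (Row g ℓ)) : IsReal L C (vanishing X v) := by
  intro s t p q _ _ h
  obtain ⟨h1, h2⟩ := vanishing_of_squaresSum hX hL h
  refine ⟨h1, fun j k => ?_⟩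
  rw [mem_vanishing, rowEval_mul_row]
  ext a
  -- A positive semidefinite matrix annihilates the zeros of its form; this yields `L q` and not
  -- `q`.
  have h3 := (hX.dotProduct_mulVec_zero_iff
    (Function.uncurry fun k => rowEval X v (q j k))).1 (by
      simpa [dotProduct_evalMat] using h2 j)
  have h4 := congrFun h3 (k, a)
  rwa [evalMat_mulVec, Function.curry_uncurry] at h4

theorem isStronglyReal_vanishing {g ν ℓ N : ℕ} {X : Fin g → Matrix (Fin N) (Fin N) ℝ}
    (v : Fin ℓ → Fin N → ℝ) {L : Matrix (Fin ν) (Fin ν) (NCPoly g)} (hX : (evalMat L X).PosDef)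
    (hL : L.IsHermitian) (C : Submodule ℝ (Row g ℓ)) : IsStronglyReal L C (vanishing X v) := by
  intro s t p q _ _ h
  obtain ⟨h1, h2⟩ := vanishing_of_squaresSum (X := X) hX.posSemidef hL h
  refine ⟨h1, fun j k => ?_⟩
  by_contra hk
  refine ((posDef_evalMat_iff X hL).1 hX _ fun h0 => hk ?_).ne' (h2 j)
  exact congrFun h0 k

/-- Rows vanishing at `(X, v)` do not contribute to the dimension of `C(X) v`. -/
theorem finrank_map_rowEval_le {g ℓ N : ℕ} (C : Submodule ℝ (Row g ℓ)) [Module.Finite ℝ C]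
    (X : Fin g → Matrix (Fin N) (Fin N) ℝ) (v : Fin ℓ → Fin N → ℝ)
    {J : Submodule (NCPoly g) (Row g ℓ)} (hJ : J ≤ vanishing X v) :
    Module.finrank ℝ (C.map (rowEval X v)) ≤ Module.finrank ℝ C -
      Module.finrank ℝ (J.restrictScalars ℝ ⊓ C : Submodule ℝ (Row g ℓ)) := by
  have h1 := ((rowEval X v).domRestrict C).finrank_range_add_finrank_ker
  rw [LinearMap.range_domRestrict] at h1
  have h2 : Module.finrank ℝ (J.restrictScalars ℝ ⊓ C : Submodule ℝ (Row g ℓ)) ≤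
      Module.finrank ℝ (LinearMap.ker ((rowEval X v).domRestrict C)) := by
    rw [← (Submodule.comapSubtypeEquivOfLe
      (inf_le_right : J.restrictScalars ℝ ⊓ C ≤ C)).finrank_eq]
    refine Submodule.finrank_mono fun c hc => ?_
    exact hJ (Submodule.mem_inf.1 (Submodule.mem_comap.1 hc)).1
  omega

/-! ### Matrix convex combinations and compressions -/

theorem single_of_mem_degLE {g : ℕ} (s : Fin g ⊕ Fin g) :
    (MonoidAlgebra.single (FreeMonoid.of s) 1 : NCPoly g) ∈ degLE g 1 :=
  Submodule.subset_span ⟨_, by simp, rfl⟩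

/-- Linear maps which agree on the empty word and on the letters agree in degree one. -/
theorem eq_of_mem_degLE_one {g : ℕ} {E : Type*} [AddCommGroup E] [Module ℝ E]
    {φ ψ : NCPoly g →ₗ[ℝ] E} (h1 : φ 1 = ψ 1)
    (hs : ∀ s, φ (MonoidAlgebra.single (FreeMonoid.of s) 1) =
      ψ (MonoidAlgebra.single (FreeMonoid.of s) 1)) {r : NCPoly g} (hr : r ∈ degLE g 1) :
    φ r = ψ r := by
  refine LinearMap.eqOn_span (s := {m | ∃ w : NCWord g, w.length ≤ 1 ∧
    m = MonoidAlgebra.single w 1}) ?_ hr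
  rintro _ ⟨w, hw, rfl⟩
  rcases Nat.le_one_iff_eq_zero_or_eq_one.1 hw with h | h
  · rw [FreeMonoid.length_eq_zero] at h
    subst h
    exact h1
  · obtain ⟨s, rfl⟩ := FreeMonoid.length_eq_one.1 h
    exact hs s

/-- Matrix convex combinations of a tuple. -/
def matrixComb {g N n : ℕ} {κ : Type*} [Fintype κ] (T : κ → Matrix (Fin N) (Fin n) ℝ)
    (X : Fin g → Matrix (Fin N) (Fin N) ℝ) (i : Fin g) : Matrix (Fin n) (Fin n) ℝ :=
  ∑ k, (T k)ᵀ * X i * T k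

/-- Degree one is essential: the condition on `T` handles the constant term, the definition handles
the letters, and products are not respected. -/
theorem eval_matrixComb {g N n : ℕ} {κ : Type*} [Fintype κ] {T : κ → Matrix (Fin N) (Fin n) ℝ}
    (hT : ∑ k, (T k)ᵀ * T k = 1) (X : Fin g → Matrix (Fin N) (Fin N) ℝ) {r : NCPoly g}
    (hr : r ∈ degLE g 1) : eval (matrixComb T X) r = ∑ k, (T k)ᵀ * eval X r * T k := by
  let ψ : NCPoly g →ₗ[ℝ] Matrix (Fin n) (Fin n) ℝ :=
    { toFun := fun r => ∑ k, (T k)ᵀ * eval X r * T k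
      map_add' := fun a b => by
        simp [Matrix.mul_add, Matrix.add_mul, Finset.sum_add_distrib]
      map_smul' := fun a b => by simp [Finset.smul_sum] }
  refine eq_of_mem_degLE_one (φ := (eval (matrixComb T X)).toLinearMap) (ψ := ψ) ?_ ?_ hr
  · simp [ψ, hT]
  · intro s
    rcases s with i | i
    · simp [ψ, eval_single_of, matrixComb]
    · simp [ψ, eval_single_of, matrixComb, Matrix.transpose_sum, Matrix.mul_assoc]

theorem quad_matrixComb {g ν N n : ℕ} {κ : Type*} [Fintype κ] {T : κ → Matrix (Fin N) (Fin n) ℝ}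
    (hT : ∑ k, (T k)ᵀ * T k = 1) (X : Fin g → Matrix (Fin N) (Fin N) ℝ)
    {L : Matrix (Fin ν) (Fin ν) (NCPoly g)} (hL : ∀ i j, L i j ∈ degLE g 1)
    (y : Fin ν → Fin n → ℝ) :
    quad (matrixComb T X) y L = ∑ k, quad X (fun j => T k *ᵥ y j) L := by
  simp only [quad_apply, rowEval_apply, dotProduct_sum]
  symm
  rw [Finset.sum_comm]
  refine Finset.sum_congr rfl fun i _ => ?_
  rw [Finset.sum_comm]
  refine Finset.sum_congr rfl fun j _ => ?_
  rw [eval_matrixComb hT X (hL i j), Matrix.sum_mulVec, dotProduct_sum]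
  refine Finset.sum_congr rfl fun k _ => Eq.symm ?_
  rw [Matrix.mul_assoc, ← mulVec_mulVec, ← mulVec_mulVec, dotProduct_mulVec, vecMul_transpose]

theorem matrixComb_mem_posDomain {g ν N n : ℕ} {κ : Type*} [Fintype κ]
    {T : κ → Matrix (Fin N) (Fin n) ℝ} (hT : ∑ k, (T k)ᵀ * T k = 1)
    {X : Fin g → Matrix (Fin N) (Fin N) ℝ} {L : Matrix (Fin ν) (Fin ν) (NCPoly g)}
    (hL : IsLinearPencil L) (hX : X ∈ posDomain L N) : matrixComb T X ∈ posDomain L n := by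
  refine (posSemidef_evalMat_iff _ hL.1).2 fun y => ?_
  rw [quad_matrixComb hT X hL.2]
  exact Finset.sum_nonneg fun k _ => (posSemidef_evalMat_iff X hL.1).1 hX _

/-- The columns of `T` are an orthonormal basis of `V` followed by zero columns, and `d` marks the
nonzero ones. -/
theorem exists_orthonormal_padding {N n : ℕ} (V : Submodule ℝ (Fin N → ℝ))
    (hV : Module.finrank ℝ V ≤ n) :
    ∃ (T : Matrix (Fin N) (Fin n) ℝ) (d : Fin n → ℝ), (∀ j, d j = 0 ∨ d j = 1) ∧
      Tᵀ * T = Matrix.diagonal d ∧ ∀ w ∈ V, T *ᵥ (Tᵀ *ᵥ w) = w := by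
  let e := (WithLp.linearEquiv 2 ℝ (Fin N → ℝ))
  let W : Submodule ℝ (EuclideanSpace ℝ (Fin N)) := V.comap e.toLinearMap
  have hW : Module.finrank ℝ W = Module.finrank ℝ V := by
    refine LinearEquiv.finrank_eq ?_
    exact (e.submoduleMap W).trans (LinearEquiv.ofEq _ _ (Submodule.map_comap_eq_of_surjective
      e.surjective V))
  obtain ⟨r, rfl⟩ := Nat.exists_eq_add_of_le (hW.trans_le hV)
  let b := stdOrthonormalBasis ℝ W
  let f : Fin (Module.finrank ℝ W + r) → Fin N → ℝ :=
    Fin.append (fun j => e (b j : EuclideanSpace ℝ (Fin N))) (fun _ => 0)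
  let F : Matrix (Fin N) (Fin (Module.finrank ℝ W + r)) ℝ := Matrix.of fun a j => f j a
  refine ⟨F, Fin.append (fun _ => 1) (fun _ => 0), fun j => ?_, ?_, fun w hw => ?_⟩
  · induction j using Fin.addCases <;> simp
  · ext i j
    have key : (Fᵀ * F) i j = f i ⬝ᵥ f j := rfl
    rw [key]
    induction i using Fin.addCases with
    | left i =>
      induction j using Fin.addCases with
      | left j =>
        have h := b.inner_eq_ite j i
        rw [Submodule.coe_inner, EuclideanSpace.inner_eq_star_dotProduct] at h
        simp only [f, Fin.append_left, Matrix.diagonal_apply, Fin.castAdd_inj]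
        simpa [e, eq_comm] using h
      | right j =>
        have : Fin.castAdd r i ≠ Fin.natAdd (Module.finrank ℝ W) j := by
          intro h
          have := congrArg Fin.val h
          simp at this
          omega
        simp [f, Matrix.diagonal_apply_ne _ this]
    | right i =>
      by_cases h : Fin.natAdd (Module.finrank ℝ W) i = j
      · subst h
        simp [f]
      · simp [f, Matrix.diagonal_apply_ne _ h]
  · have h := congrArg (fun z : W => e (z : EuclideanSpace ℝ (Fin N)))
      (b.sum_repr' ⟨e.symm w, by simpa [W] using hw⟩)
    simp only [Submodule.coe_sum, map_sum, Submodule.coe_smul, map_smul, Submodule.coe_inner,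
      LinearEquiv.apply_symm_apply, EuclideanSpace.inner_eq_star_dotProduct] at h
    refine Eq.trans ?_ h
    ext a
    have key : (F *ᵥ (Fᵀ *ᵥ w)) a = ∑ j, f j a * (f j ⬝ᵥ w) := rfl
    rw [key, Fin.sum_univ_add]
    simp [f, e, dotProduct_comm, mul_comm]

/-- Compression of a tuple to a space of dimension at most `n`, filled up to size `n` by
one-dimensional compressions. -/
theorem exists_compression {g ν N n : ℕ} {X : Fin g → Matrix (Fin N) (Fin N) ℝ}
    {L : Matrix (Fin ν) (Fin ν) (NCPoly g)} (hL : IsLinearPencil L) (hX : X ∈ posDomain L N)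
    (hN : 0 < N) (V : Submodule ℝ (Fin N → ℝ)) (hV : Module.finrank ℝ V ≤ n) :
    ∃ (Y : Fin g → Matrix (Fin n) (Fin n) ℝ) (T : Matrix (Fin N) (Fin n) ℝ),
      Y ∈ posDomain L n ∧ (∀ w ∈ V, T *ᵥ (Tᵀ *ᵥ w) = w) ∧
      ∀ r ∈ degLE g 1, ∀ w ∈ V, eval Y r *ᵥ (Tᵀ *ᵥ w) = Tᵀ *ᵥ (eval X r *ᵥ w) := by
  obtain ⟨T, d, hd, hTT, hT⟩ := exists_orthonormal_padding V hV
  -- Each zero column `k` of `T` is compensated by a compression to the first coordinate, placed at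
  -- diagonal position `k`; this is where `0 < N` enters.
  let S : Option (Fin n) → Matrix (Fin N) (Fin n) ℝ := fun o =>
    o.elim T fun k => Matrix.single ⟨0, hN⟩ k (1 - d k)
  have hsq (k) : (1 - d k) * (1 - d k) = 1 - d k := by
    rcases hd k with h | h <;> simp [h]
  have hS : ∑ k, (S k)ᵀ * S k = 1 := by
    simp only [S, Fintype.sum_option, Option.elim_none, Option.elim_some, Matrix.transpose_single,
      Matrix.single_mul_single_same, hsq, hTT]
    ext i j
    simp only [Matrix.add_apply, Matrix.sum_apply, Matrix.single_apply, Matrix.diagonal_apply,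
      Matrix.one_apply]
    by_cases hij : i = j
    · subst hij
      simp
    · rw [Finset.sum_eq_zero]
      · simp [hij]
      · rintro k -
        rw [if_neg]
        rintro ⟨rfl, rfl⟩
        exact hij rfl
  -- The padding does not see the vectors `Tᵀ w`: their entry `k` vanishes when `d k = 0`, and the
  -- padding matrix vanishes when `d k = 1`.
  have hzero (k : Fin n) : Matrix.single ⟨0, hN⟩ k (1 - d k) * Tᵀ =
      (0 : Matrix (Fin N) (Fin N) ℝ) := by
    have h1 : d k * d k = d k := by rcases hd k with h | h <;> simp [h]
    ext a b
    by_cases ha : a = ⟨0, hN⟩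
    · subst ha
      rw [Matrix.single_mul_apply_same]
      rcases hd k with h | h
      · have h2 := congrFun (congrFun hTT k) k
        rw [Matrix.diagonal_apply_eq, h, Matrix.mul_apply] at h2
        have h3 := (Finset.sum_eq_zero_iff_of_nonneg (fun c _ => by
          simpa using mul_self_nonneg (T c k))).1 h2 b (Finset.mem_univ b)
        simp at h3
        simp [h3]
      · simp [h]
    · rw [Matrix.single_mul_apply_of_ne _ _ _ _ _ ha]
      rfl
  refine ⟨matrixComb S X, T, matrixComb_mem_posDomain hS hL hX, hT, fun r hr w hw => ?_⟩
  rw [eval_matrixComb hS X hr, Fintype.sum_option, Matrix.add_mulVec, Matrix.sum_mulVec,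
    Finset.sum_eq_zero, add_zero]
  · change (Tᵀ * eval X r * T) *ᵥ (Tᵀ *ᵥ w) = _
    rw [← mulVec_mulVec, hT w hw, ← mulVec_mulVec]
  · rintro k -
    change (_ * Matrix.single (⟨0, hN⟩ : Fin N) k (1 - d k)) *ᵥ (Tᵀ *ᵥ w) = _
    rw [mulVec_mulVec, Matrix.mul_assoc, hzero, Matrix.mul_zero, Matrix.zero_mulVec]

/-! ### Transfer of positivity to the compression -/

theorem quad_chipProduct_generator {g ℓ N : ℕ} (X : Fin g → Matrix (Fin N) (Fin N) ℝ)
    (v : Fin ℓ → Fin N → ℝ) (c d : Row g ℓ) (r : NCPoly g) :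
    quad X v (vecMulVec (star c) (r • d)) = rowEval X v c ⬝ᵥ (eval X r *ᵥ rowEval X v d) := by
  rw [quad_vecMulVec, rowEval_poly_smul]

/-- Rows of a full right chip space intertwine with a compression to the space `C(X) v`. -/
theorem rowEval_compression {g ℓ N n : ℕ} {C : Submodule ℝ (Row g ℓ)} (hC : IsRightChipSpace C)
    (hfull : IsFull C) {X : Fin g → Matrix (Fin N) (Fin N) ℝ} {v : Fin ℓ → Fin N → ℝ}
    {Y : Fin g → Matrix (Fin n) (Fin n) ℝ} {T : Matrix (Fin N) (Fin n) ℝ}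
    (hY : ∀ r ∈ degLE g 1, ∀ w ∈ C.map (rowEval X v),
      eval Y r *ᵥ (Tᵀ *ᵥ w) = Tᵀ *ᵥ (eval X r *ᵥ w)) {c : Row g ℓ} (hc : c ∈ C) :
    rowEval Y (fun i => Tᵀ *ᵥ v i) c = Tᵀ *ᵥ rowEval X v c := by
  have hmon (i : Fin ℓ) (w : NCWord g) (hw : monomial i w ∈ C) :
      rowEval Y (fun i => Tᵀ *ᵥ v i) (monomial i w) = Tᵀ *ᵥ rowEval X v (monomial i w) := by
    induction w using FreeMonoid.inductionOn' with
    | one => simp [rowEval_monomial, ← MonoidAlgebra.one_def]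
    | of_mul s w ih =>
      -- Without its leftmost letter the word is still a chip of `C`, so its value lies in the space
      -- on which `Y` intertwines.
      have hw' := hfull i _ _ hw
      rw [← poly_smul_monomial, rowEval_poly_smul, rowEval_poly_smul, ih hw',
        hY _ (single_of_mem_degLE s) _ ⟨_, hw', rfl⟩]
  obtain ⟨⟨S, hS⟩, -⟩ := hC
  have heq : Set.EqOn (rowEval Y (fun i => Tᵀ *ᵥ v i))
      ((Matrix.mulVecLin Tᵀ).comp (rowEval X v)) ((fun m => monomial m.1 m.2) '' S) := by
    rintro _ ⟨m, hm, rfl⟩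
    exact hmon m.1 m.2 (hS ▸ Submodule.subset_span (Set.mem_image_of_mem _ hm))
  exact LinearMap.eqOn_span heq (hS ▸ hc)

theorem quad_compression {g ℓ N n : ℕ} {C : Submodule ℝ (Row g ℓ)} (hC : IsRightChipSpace C)
    (hfull : IsFull C) {X : Fin g → Matrix (Fin N) (Fin N) ℝ} {v : Fin ℓ → Fin N → ℝ}
    {Y : Fin g → Matrix (Fin n) (Fin n) ℝ} {T : Matrix (Fin N) (Fin n) ℝ}
    (hT : ∀ w ∈ C.map (rowEval X v), T *ᵥ (Tᵀ *ᵥ w) = w)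
    (hY : ∀ r ∈ degLE g 1, ∀ w ∈ C.map (rowEval X v),
      eval Y r *ᵥ (Tᵀ *ᵥ w) = Tᵀ *ᵥ (eval X r *ᵥ w))
    {p : Matrix (Fin ℓ) (Fin ℓ) (NCPoly g)} (hp : p ∈ chipProducts C) :
    quad Y (fun i => Tᵀ *ᵥ v i) p = quad X v p := by
  refine LinearMap.eqOn_span (s := {M | ∃ c ∈ C, ∃ d ∈ C, ∃ r ∈ degLE g 1,
    M = Matrix.vecMulVec (star c) (r • d)}) ?_ hp
  rintro _ ⟨c, hc, d, hd, r, hr, rfl⟩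
  rw [quad_chipProduct_generator, quad_chipProduct_generator, rowEval_compression hC hfull hY hc,
    rowEval_compression hC hfull hY hd, hY r hr _ ⟨d, hd, rfl⟩, dotProduct_mulVec, vecMul_transpose,
    hT _ ⟨c, hc, rfl⟩]

theorem quad_eq_zero_of_chips {g ℓ N : ℕ} {C : Submodule ℝ (Row g ℓ)}
    {X : Fin g → Matrix (Fin N) (Fin N) ℝ} {v : Fin ℓ → Fin N → ℝ}
    (h : ∀ c ∈ C, rowEval X v c = 0) {p : Matrix (Fin ℓ) (Fin ℓ) (NCPoly g)}
    (hp : p ∈ chipProducts C) : quad X v p = 0 := by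
  refine LinearMap.eqOn_span (s := {M | ∃ c ∈ C, ∃ d ∈ C, ∃ r ∈ degLE g 1,
    M = Matrix.vecMulVec (star c) (r • d)}) (g := 0) ?_ hp
  rintro _ ⟨c, hc, d, hd, r, hr, rfl⟩
  rw [quad_chipProduct_generator, h c hc, zero_dotProduct]
  rfl

/-- A coordinate without chips is invisible to the rows of `C`. -/
theorem rowEval_single_eq_zero {g ℓ N : ℕ} {C : Submodule ℝ (Row g ℓ)}
    (hC : IsRightChipSpace C) (hfull : IsFull C) {i : Fin ℓ} (hi : monomial i 1 ∉ C)
    (X : Fin g → Matrix (Fin N) (Fin N) ℝ) (u : Fin N → ℝ) {c : Row g ℓ} (hc : c ∈ C) :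
    rowEval X (Pi.single i u) c = 0 := by
  obtain ⟨⟨S, hS⟩, -⟩ := hC
  have heq : Set.EqOn (rowEval X (Pi.single i u)) (0 : Row g ℓ →ₗ[ℝ] Fin N → ℝ)
      ((fun m => monomial m.1 m.2) '' S) := by
    rintro _ ⟨m, hm, rfl⟩
    have hmC : monomial m.1 m.2 ∈ C := hS ▸ Submodule.subset_span (Set.mem_image_of_mem _ hm)
    have hne : m.1 ≠ i := by
      rintro rfl
      exact hi (hfull m.1 m.2 1 (by rwa [mul_one]))
    rw [rowEval_monomial, Pi.single_eq_of_ne hne, Matrix.mulVec_zero]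
    rfl
  exact LinearMap.eqOn_span heq (hS ▸ hc)

/-- The case `n = 0` needs no separate treatment: the form then equals one on vectors of length
zero. -/
theorem nonnegOn_of_finrank_le {g ν ℓ N n : ℕ} {C : Submodule ℝ (Row g ℓ)}
    (hC : IsRightChipSpace C) (hfull : IsFull C) {L : Matrix (Fin ν) (Fin ν) (NCPoly g)}
    (hL : IsLinearPencil L) {p : Matrix (Fin ℓ) (Fin ℓ) (NCPoly g)} (hp : p ∈ chipProducts C)
    (hsymm : p.IsHermitian)
    (hn : ∀ X ∈ posDomain L N, ∀ v, Module.finrank ℝ (C.map (rowEval X v)) ≤ n)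
    (h : NonnegOn p L n) : NonnegOn p L N := by
  intro X hX
  refine (posSemidef_evalMat_iff X hsymm).2 fun v => ?_
  rcases Nat.eq_zero_or_pos N with rfl | hN
  · simp [quad_apply, dotProduct]
  obtain ⟨Y, T, hYL, hT, hY⟩ := exists_compression hL hX hN _ (hn X hX v)
  rw [← quad_compression hC hfull hT hY hp]
  exact (posSemidef_evalMat_iff Y hsymm).1 (h Y hYL) _

theorem posOn_of_finrank_le {g ν ℓ N n : ℕ} {C : Submodule ℝ (Row g ℓ)}
    (hC : IsRightChipSpace C) (hfull : IsFull C) {L : Matrix (Fin ν) (Fin ν) (NCPoly g)}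
    (hL : IsLinearPencil L) {p : Matrix (Fin ℓ) (Fin ℓ) (NCPoly g)} (hp : p ∈ chipProducts C)
    (hsymm : p.IsHermitian)
    (hn : ∀ X ∈ posDomain L N, ∀ v, Module.finrank ℝ (C.map (rowEval X v)) ≤ n)
    (hn0 : 0 < n) (h : PosOn p L n) : PosOn p L N := by
  intro X hX
  refine (posDef_evalMat_iff X hsymm).2 fun v hv => ?_
  rcases Nat.eq_zero_or_pos N with rfl | hN
  · exact absurd (Subsingleton.elim _ _) hv
  obtain ⟨Y, T, hYL, hT, hY⟩ := exists_compression hL hX hN _ (hn X hX v)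
  have hYp := (posDef_evalMat_iff Y hsymm).1 (h Y hYL)
  -- If `e_i ⊗ 1` were missing, no row of `C` would involve coordinate `i`, and the form of `p` at
  -- `Y` would vanish on a nonzero vector. Hence each `v i` lies in the compressed space, and `Tᵀ`
  -- does not kill a nonzero `v`.
  have hmon (i : Fin ℓ) : monomial i 1 ∈ C := by
    by_contra hi
    have hu : (Pi.single i (fun _ => 1) : Fin ℓ → Fin n → ℝ) ≠ 0 := fun h0 => by
      have h1 := congrFun (congrFun h0 i) ⟨0, hn0⟩
      simp at h1
    exact (hYp _ hu).ne'
      (quad_eq_zero_of_chips (fun c hc => rowEval_single_eq_zero hC hfull hi Y _ hc) hp)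
  rw [← quad_compression hC hfull hT hY hp]
  refine hYp _ fun h0 => hv ?_
  ext1 i
  have hvi : v i ∈ C.map (rowEval X v) :=
    ⟨_, hmon i, by simp [rowEval_monomial, ← MonoidAlgebra.one_def]⟩
  rw [← hT _ hvi, congrFun h0 i]
  exact Matrix.mulVec_zero _

/-! ### Real points and the alternative for strict feasibility -/

/-- Evaluation at a tuple of real numbers. -/
def scalarEval {g : ℕ} (x : Fin g → ℝ) : NCPoly g →ₐ[ℝ] ℝ :=
  MonoidAlgebra.lift ℝ ℝ (NCWord g) (FreeMonoid.lift (Sum.elim x x))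

theorem scalarEval_single_of {g : ℕ} (x : Fin g → ℝ) (s : Fin g ⊕ Fin g) :
    scalarEval x (MonoidAlgebra.single (FreeMonoid.of s) 1) = Sum.elim x x s := by
  simp [scalarEval]

theorem eval_scalar {g N : ℕ} (x : Fin g → ℝ) (p : NCPoly g) :
    eval (fun i => x i • (1 : Matrix (Fin N) (Fin N) ℝ)) p = scalarEval x p • 1 := by
  have h : eval (fun i => x i • (1 : Matrix (Fin N) (Fin N) ℝ)) =
      (Algebra.ofId ℝ (Matrix (Fin N) (Fin N) ℝ)).comp (scalarEval x) := by
    apply algHom_ext_letters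
    intro s
    rw [AlgHom.comp_apply, eval_single_of, scalarEval_single_of, Algebra.ofId_apply,
      Algebra.algebraMap_eq_smul_one]
    rcases s with i | i <;> simp
  rw [h, AlgHom.comp_apply, Algebra.ofId_apply, Algebra.algebraMap_eq_smul_one]

theorem scalarEval_of_mem_degLE_one {g : ℕ} (x : Fin g → ℝ) {r : NCPoly g} (hr : r ∈ degLE g 1) :
    scalarEval x r = scalarEval 0 r +
      ∑ i, x i * (scalarEval (Pi.single i 1) r - scalarEval 0 r) := by
  let ψ : NCPoly g →ₗ[ℝ] ℝ := (scalarEval 0).toLinearMap +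
    ∑ i, x i • ((scalarEval (Pi.single i 1)).toLinearMap - (scalarEval 0).toLinearMap)
  have h := eq_of_mem_degLE_one (φ := (scalarEval x).toLinearMap) (ψ := ψ)
    (by simp [ψ]) (fun s => by
      rcases s with i | i <;> simp [ψ, scalarEval_single_of, Pi.single_apply]) hr
  simpa [ψ] using h

/-- A symmetric polynomial of degree one is determined by its values at real points. -/
theorem eq_algebraMap_of_scalarEval {g : ℕ} {r : NCPoly g} (hr : r ∈ degLE g 1) (hs : star r = r)
    (h : ∀ i, scalarEval (Pi.single i 1) r - scalarEval 0 r = 0) :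
    r = algebraMap ℝ (NCPoly g) (scalarEval 0 r) := by
  let letter (s : Fin g ⊕ Fin g) : NCPoly g := MonoidAlgebra.single (FreeMonoid.of s) 1
  let σ : NCPoly g →ₗ[ℝ] NCPoly g :=
    { toFun := fun r => r + star r
      map_add' := fun a b => by rw [star_add]; abel
      map_smul' := fun a b => by rw [star_real_smul, RingHom.id_apply, smul_add] }
  -- In degree one, `r + r^*` is a combination of `1` and the `x_i + x_i^*`, with coefficients that
  -- real points detect.
  let ψ : NCPoly g →ₗ[ℝ] NCPoly g :=
    (2 : ℝ) • (Algebra.linearMap ℝ (NCPoly g)).comp (scalarEval 0).toLinearMap +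
    ∑ i, ((scalarEval (Pi.single i 1)).toLinearMap - (scalarEval 0).toLinearMap).smulRight
      (letter (Sum.inl i) + letter (Sum.inr i))
  have key := eq_of_mem_degLE_one (φ := σ) (ψ := ψ)
    (by simp [ψ, σ, two_smul, ← MonoidAlgebra.one_def]) (fun s => by
      rcases s with i | i <;>
      · simp only [ψ, σ, scalarEval_single_of, star_single_of, letter, LinearMap.coe_mk,
          AddHom.coe_mk, LinearMap.add_apply, LinearMap.smul_apply, LinearMap.comp_apply,
          AlgHom.toLinearMap_apply, LinearMap.sum_apply, LinearMap.smulRight_apply,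
          LinearMap.sub_apply, Sum.elim_inl, Sum.elim_inr, Pi.single_apply, Pi.zero_apply, map_zero,
          smul_zero, zero_add, sub_zero, ite_smul, one_smul, zero_smul, Finset.sum_ite_eq,
          Finset.mem_univ, if_true, Sum.swap_inl, Sum.swap_inr]
        try abel) hr
  have key' : (2 : ℝ) • r = (2 : ℝ) • algebraMap ℝ (NCPoly g) (scalarEval 0 r) := by
    simpa only [ψ, σ, hs, h, LinearMap.coe_mk, AddHom.coe_mk, ← two_smul ℝ r, LinearMap.add_apply,
      LinearMap.smul_apply, LinearMap.comp_apply, AlgHom.toLinearMap_apply, LinearMap.sum_apply,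
      LinearMap.smulRight_apply, LinearMap.sub_apply, zero_smul, Finset.sum_const_zero, add_zero,
      Algebra.linearMap_apply] using key
  exact smul_right_injective _ (two_ne_zero' ℝ) key'

/-- The contraction `∑ G_{kl} L_{kl}` of a pencil with a real matrix. -/
def contraction {g ν : ℕ} (L : Matrix (Fin ν) (Fin ν) (NCPoly g)) :
    Matrix (Fin ν) (Fin ν) ℝ →ₗ[ℝ] NCPoly g where
  toFun G := ∑ k, ∑ l, G k l • L k l
  map_add' G H := by simp [add_smul, Finset.sum_add_distrib]
  map_smul' a G := by simp [mul_smul, Finset.smul_sum]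

theorem contraction_apply {g ν : ℕ} (L : Matrix (Fin ν) (Fin ν) (NCPoly g))
    (G : Matrix (Fin ν) (Fin ν) ℝ) : contraction L G = ∑ k, ∑ l, G k l • L k l := rfl

theorem contraction_mem_degLE {g ν : ℕ} {L : Matrix (Fin ν) (Fin ν) (NCPoly g)}
    (hL : IsLinearPencil L) (G : Matrix (Fin ν) (Fin ν) ℝ) : contraction L G ∈ degLE g 1 := by
  rw [contraction_apply]
  exact Submodule.sum_mem _ fun k _ => Submodule.sum_mem _ fun l _ =>
    Submodule.smul_mem _ _ (hL.2 k l)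

theorem star_contraction {g ν : ℕ} {L : Matrix (Fin ν) (Fin ν) (NCPoly g)}
    (hL : IsLinearPencil L) {G : Matrix (Fin ν) (Fin ν) ℝ} (hG : G.IsHermitian) :
    star (contraction L G) = contraction L G := by
  simp only [contraction_apply, star_sum, star_real_smul]
  rw [Finset.sum_comm]
  refine Finset.sum_congr rfl fun k _ => Finset.sum_congr rfl fun l _ => ?_
  rw [hL.1.apply]
  congr 1
  simpa using hG.apply k l

theorem scalarEval_contraction_vecMulVec {g ν : ℕ} (x : Fin g → ℝ)
    (L : Matrix (Fin ν) (Fin ν) (NCPoly g)) (y : Fin ν → ℝ) :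
    scalarEval x (contraction L (vecMulVec y y)) = y ⬝ᵥ (L.map (scalarEval x) *ᵥ y) := by
  simp only [contraction_apply, map_sum, map_smul, dotProduct, mulVec, Finset.mul_sum,
    vecMulVec_apply, smul_eq_mul, Matrix.map_apply]
  exact Finset.sum_congr rfl fun k _ => Finset.sum_congr rfl fun l _ => by ring

/-- The positive semidefinite matrices of trace one. -/
def densityMatrices (ν : ℕ) : Set (Matrix (Fin ν) (Fin ν) ℝ) := {G | G.PosSemidef ∧ G.trace = 1}

theorem convex_densityMatrices (ν : ℕ) : Convex ℝ (densityMatrices ν) := by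
  rintro G ⟨hG, hG1⟩ H ⟨hH, hH1⟩ a b ha hb hab
  refine ⟨(hG.smul ha).add (hH.smul hb), ?_⟩
  rw [trace_add, trace_smul, trace_smul, hG1, hH1]
  simpa using hab

open scoped MatrixOrder in
theorem posSemidef_iff_exists_gram {ν : ℕ} {G : Matrix (Fin ν) (Fin ν) ℝ} :
    G.PosSemidef ↔ ∃ B : Matrix (Fin ν) (Fin ν) ℝ, G = Bᵀ * B := by
  constructor
  · intro h
    obtain ⟨B, rfl⟩ := CStarAlgebra.nonneg_iff_eq_star_mul_self.mp h.nonneg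
    exact ⟨B, by rw [star_eq_conjTranspose, conjTranspose_eq_transpose_of_trivial]⟩
  · rintro ⟨B, rfl⟩
    simpa using posSemidef_conjTranspose_mul_self B

theorem trace_gram {ν : ℕ} (B : Matrix (Fin ν) (Fin ν) ℝ) :
    (Bᵀ * B).trace = ∑ i, ∑ j, B i j ^ 2 := by
  rw [Finset.sum_comm]
  simp [Matrix.trace, Matrix.mul_apply, sq]

/-- The set is the image of the Frobenius unit sphere under `B ↦ Bᵀ B`. -/
theorem isCompact_densityMatrices (ν : ℕ) : IsCompact (densityMatrices ν) := by
  have hS : IsCompact {B : Matrix (Fin ν) (Fin ν) ℝ | ∑ i, ∑ j, B i j ^ 2 = 1} := by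
    have hbox : IsCompact (Set.univ.pi fun _ : Fin ν => Set.univ.pi fun _ : Fin ν =>
        Set.Icc (-1 : ℝ) 1) :=
      isCompact_univ_pi fun _ => isCompact_univ_pi fun _ => isCompact_Icc
    refine hbox.of_isClosed_subset (isClosed_eq (by fun_prop) continuous_const) ?_
    intro B hB i _ j _
    have h1 : B i j ^ 2 ≤ ∑ j, B i j ^ 2 :=
      Finset.single_le_sum (f := fun j => B i j ^ 2) (fun _ _ => sq_nonneg _) (Finset.mem_univ j)
    have h2 : ∑ j, B i j ^ 2 ≤ ∑ i, ∑ j, B i j ^ 2 :=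
      Finset.single_le_sum (f := fun i => ∑ j, B i j ^ 2)
        (fun _ _ => Finset.sum_nonneg fun _ _ => sq_nonneg _) (Finset.mem_univ i)
    exact abs_le.1 ((sq_le_one_iff_abs_le_one _).1 (h1.trans (h2.trans_eq hB)))
  have him : densityMatrices ν = (fun B : Matrix (Fin ν) (Fin ν) ℝ => Bᵀ * B) ''
      {B | ∑ i, ∑ j, B i j ^ 2 = 1} := by
    ext G
    constructor
    · rintro ⟨h1, h2⟩
      obtain ⟨B, rfl⟩ := posSemidef_iff_exists_gram.1 h1
      exact ⟨B, by rwa [trace_gram] at h2, rfl⟩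
    · rintro ⟨B, hB, rfl⟩
      exact ⟨posSemidef_iff_exists_gram.2 ⟨B, rfl⟩, by rwa [trace_gram]⟩
  rw [him]
  exact hS.image (by fun_prop)

/-- The coefficients of the contraction, as an affine function on real points. -/
def contractionCoeffs {g ν : ℕ} (L : Matrix (Fin ν) (Fin ν) (NCPoly g)) :
    Matrix (Fin ν) (Fin ν) ℝ →ₗ[ℝ] ℝ × (Fin g → ℝ) :=
  ((scalarEval 0).toLinearMap.prod (LinearMap.pi fun i =>
    (scalarEval (Pi.single i 1)).toLinearMap - (scalarEval 0).toLinearMap)).comp (contraction L)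

/-- The alternative for the feasibility of a strict linear matrix inequality. -/
theorem exists_contraction_or_exists_pos {g ν : ℕ} {L : Matrix (Fin ν) (Fin ν) (NCPoly g)}
    (hL : IsLinearPencil L) :
    (∃ G ∈ densityMatrices ν, ∃ a : ℝ, a ≤ 0 ∧ contraction L G = algebraMap ℝ (NCPoly g) a) ∨
    ∃ x : Fin g → ℝ, ∀ G ∈ densityMatrices ν, 0 < scalarEval x (contraction L G) := by
  rw [or_iff_not_imp_left]
  intro hno
  set φ := contractionCoeffs L
  have hφc : Continuous φ := φ.continuous_of_finiteDimensional
  have hconv : Convex ℝ (φ '' densityMatrices ν) := (convex_densityMatrices ν).linear_image φ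
  have hcomp : IsCompact (φ '' densityMatrices ν) := (isCompact_densityMatrices ν).image hφc
  -- Meeting `R` means contracting `L` to a constant `a ≤ 0`, the excluded alternative.
  let R : Set (ℝ × (Fin g → ℝ)) := Set.Iic 0 ×ˢ {0}
  have hR : Convex ℝ R := (convex_Iic 0).prod (convex_singleton 0)
  have hRc : IsClosed R := isClosed_Iic.prod isClosed_singleton
  have hdisj : Disjoint (φ '' densityMatrices ν) R := by
    rw [Set.disjoint_left]
    rintro _ ⟨G, hG, rfl⟩ ⟨h1, h2⟩
    refine hno ⟨G, hG, scalarEval 0 (contraction L G), h1, ?_⟩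
    exact eq_algebraMap_of_scalarEval (contraction_mem_degLE hL G) (star_contraction hL hG.1.1)
      fun i => congrFun h2 i
  obtain ⟨f, u, w, hfu, huw, hfw⟩ := geometric_hahn_banach_compact_closed hconv hcomp hR hRc hdisj
  have hw0 : w < 0 := by
    have := hfw (0, 0) ⟨le_refl (0 : ℝ), rfl⟩
    rwa [show ((0 : ℝ), (0 : Fin g → ℝ)) = 0 from rfl, map_zero] at this
  have hf (a : ℝ) (b : Fin g → ℝ) : f (a, b) = a * f (1, 0) + ∑ i, b i * f (0, Pi.single i 1) := by
    have h : (a, b) = a • ((1 : ℝ), (0 : Fin g → ℝ)) +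
        ∑ i, b i • ((0 : ℝ), (Pi.single i 1 : Fin g → ℝ)) := by
      ext j
      · simp [Prod.fst_sum]
      · simp [Prod.snd_sum, Pi.single_apply]
    rw [h, map_add, map_smul, map_sum]
    simp only [map_smul, smul_eq_mul]
  have hf0 : f (1, 0) ≤ 0 := by
    by_contra! hpos
    have := hfw (w / f (1, 0), 0) ⟨(div_neg_of_neg_of_pos hw0 hpos).le, rfl⟩
    rw [hf] at this
    simp [hpos.ne'] at this
  obtain ⟨M, hM⟩ := (isCompact_densityMatrices ν).exists_bound_of_continuousOn
    (f := fun G => (φ G).1) (by fun_prop)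
  -- The natural point divides by `f (1, 0)`, which may be zero. Lowering it by `δ` makes it
  -- negative, and `δ` is small enough that the error on the compact set stays within the gap `-w`.
  let δ : ℝ := -w / (|M| + 1)
  have hM1 : 0 < |M| + 1 := by positivity
  have hδ : 0 < δ := div_pos (neg_pos.2 hw0) hM1
  let c : ℝ := f (1, 0) - δ
  have hc : c < 0 := by simp only [c]; linarith
  refine ⟨fun i => f (0, Pi.single i 1) / c, fun G hG => ?_⟩
  rw [scalarEval_of_mem_degLE_one _ (contraction_mem_degLE hL G)]
  have h1 := hfu _ ⟨G, hG, rfl⟩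
  rw [← Prod.mk.eta (p := φ G), hf] at h1
  have h2 : |(φ G).1| ≤ |M| := (hM G hG).trans (le_abs_self M)
  have h3 : -(δ * (φ G).1) ≤ -w := by
    have h4 : δ * |M| ≤ -w := by
      have : δ * (|M| + 1) = -w := div_mul_cancel₀ _ hM1.ne'
      linarith
    have h5 := mul_le_mul_of_nonneg_left ((neg_le_abs _).trans h2) hδ.le
    linarith
  have h6 : c * ((φ G).1 + ∑ i, f (0, Pi.single i 1) / c * (φ G).2 i) < 0 := by
    have : c * ((φ G).1 + ∑ i, f (0, Pi.single i 1) / c * (φ G).2 i) =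
        (φ G).1 * f (1, 0) + ∑ i, (φ G).2 i * f (0, Pi.single i 1) - δ * (φ G).1 := by
      rw [mul_add, Finset.mul_sum]
      have h7 (i) : c * (f (0, Pi.single i 1) / c * (φ G).2 i) =
          (φ G).2 i * f (0, Pi.single i 1) := by
        field_simp [hc.ne]
      simp only [h7, c]
      ring
    rw [this]
    linarith
  exact pos_of_mul_neg_right h6 hc.le

/-! ### Consequences of a strictly feasible real point -/

/-- Normalised to trace one, `y yᵀ` is a density matrix. -/
theorem posDef_map_scalarEval {g ν : ℕ} {L : Matrix (Fin ν) (Fin ν) (NCPoly g)}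
    {x : Fin g → ℝ} (hx : ∀ G ∈ densityMatrices ν, 0 < scalarEval x (contraction L G))
    {y : Fin ν → ℝ} (hy : y ≠ 0) : 0 < y ⬝ᵥ (L.map (scalarEval x) *ᵥ y) := by
  have hpos : 0 < y ⬝ᵥ y := by simpa using dotProduct_star_self_pos_iff.2 hy
  have hG : (y ⬝ᵥ y)⁻¹ • vecMulVec y y ∈ densityMatrices ν := by
    refine ⟨?_, ?_⟩
    · have := (posSemidef_vecMulVec_self_star y).smul (inv_nonneg.2 hpos.le)
      simpa using this
    · rw [trace_smul, trace_vecMulVec, smul_eq_mul, inv_mul_cancel₀ hpos.ne']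
  have h := hx _ hG
  rw [map_smul, map_smul, smul_eq_mul, scalarEval_contraction_vecMulVec] at h
  exact (pos_iff_pos_of_mul_pos h).1 (inv_pos.2 hpos)

theorem quad_scalar_pos {g ν N : ℕ} {L : Matrix (Fin ν) (Fin ν) (NCPoly g)}
    {x : Fin g → ℝ} (hx : ∀ G ∈ densityMatrices ν, 0 < scalarEval x (contraction L G))
    {v : Fin ν → Fin N → ℝ} (hv : v ≠ 0) :
    0 < quad (fun i => x i • (1 : Matrix (Fin N) (Fin N) ℝ)) v L := by
  -- At a scalar tuple the form of `L` splits into one copy of `L(x)` per coordinate of `Fin N`.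
  have h : quad (fun i => x i • (1 : Matrix (Fin N) (Fin N) ℝ)) v L =
      ∑ a, (fun k => v k a) ⬝ᵥ (L.map (scalarEval x) *ᵥ fun k => v k a) := by
    simp only [quad_apply, rowEval_apply, eval_scalar, Matrix.smul_mulVec, Matrix.one_mulVec,
      dotProduct, mulVec, Finset.sum_apply, Pi.smul_apply, smul_eq_mul, Matrix.map_apply]
    exact Finset.sum_comm
  rw [h]
  obtain ⟨k, hk⟩ := Function.ne_iff.1 hv
  obtain ⟨a, ha⟩ := Function.ne_iff.1 hk
  refine Finset.sum_pos' (fun b _ => ?_) ⟨a, Finset.mem_univ a,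
    posDef_map_scalarEval hx fun h0 => ha (congrFun h0 k)⟩
  by_cases h0 : (fun k => v k b) = 0
  · rw [h0, zero_dotProduct]
  · exact (posDef_map_scalarEval hx h0).le

/-- The segment from a tuple to a real point. -/
def segmentTo {g N : ℕ} (X : Fin g → Matrix (Fin N) (Fin N) ℝ) (x : Fin g → ℝ) (t : ℝ)
    (i : Fin g) : Matrix (Fin N) (Fin N) ℝ := (1 - t) • X i + t • (x i • 1)

theorem eval_segmentTo {g N : ℕ} (X : Fin g → Matrix (Fin N) (Fin N) ℝ) (x : Fin g → ℝ) (t : ℝ)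
    {r : NCPoly g} (hr : r ∈ degLE g 1) :
    eval (segmentTo X x t) r = (1 - t) • eval X r + t • eval (fun i => x i • 1) r := by
  refine eq_of_mem_degLE_one (φ := (eval (segmentTo X x t)).toLinearMap)
    (ψ := (1 - t) • (eval X).toLinearMap + t • (eval (fun i => x i • 1)).toLinearMap) ?_ ?_ hr
  · simp [← add_smul]
  · rintro (i | i) <;> simp [eval_single_of, segmentTo]

theorem quad_segmentTo {g ν N : ℕ} {L : Matrix (Fin ν) (Fin ν) (NCPoly g)}
    (hL : IsLinearPencil L) (X : Fin g → Matrix (Fin N) (Fin N) ℝ) (x : Fin g → ℝ) (t : ℝ)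
    (v : Fin ν → Fin N → ℝ) : quad (segmentTo X x t) v L =
      (1 - t) * quad X v L + t * quad (fun i => x i • 1) v L := by
  simp only [quad_apply, rowEval_apply, eval_segmentTo X x t (hL.2 _ _), Matrix.add_mulVec,
    Matrix.smul_mulVec, Finset.sum_add_distrib, dotProduct_add, ← Finset.smul_sum,
    dotProduct_smul, smul_eq_mul, Finset.mul_sum]

theorem posDef_segmentTo {g ν N : ℕ} {L : Matrix (Fin ν) (Fin ν) (NCPoly g)}
    (hL : IsLinearPencil L) {x : Fin g → ℝ}
    (hx : ∀ G ∈ densityMatrices ν, 0 < scalarEval x (contraction L G))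
    {X : Fin g → Matrix (Fin N) (Fin N) ℝ} (hX : X ∈ posDomain L N) {t : ℝ} (ht : 0 < t)
    (ht1 : t ≤ 1) : (evalMat L (segmentTo X x t)).PosDef := by
  refine (posDef_evalMat_iff _ hL.1).2 fun v hv => ?_
  rw [quad_segmentTo hL]
  exact add_pos_of_nonneg_of_pos
    (mul_nonneg (sub_nonneg.2 ht1) ((posSemidef_evalMat_iff X hL.1).1 hX v))
    (mul_pos ht (quad_scalar_pos hx hv))

theorem continuous_eval {g N : ℕ} (r : NCPoly g) :
    Continuous fun X : Fin g → Matrix (Fin N) (Fin N) ℝ => eval X r := by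
  induction r using MonoidAlgebra.induction_linear with
  | zero => simpa using continuous_const
  | add p q hp hq => simpa only [map_add] using Continuous.fun_add hp hq
  | single w a =>
    have hw : Continuous fun X : Fin g → Matrix (Fin N) (Fin N) ℝ =>
        FreeMonoid.lift (Sum.elim X fun i => (X i)ᵀ) w := by
      induction w using FreeMonoid.inductionOn' with
      | one => simpa using continuous_const
      | of_mul s w ih =>
        simp only [map_mul, FreeMonoid.lift_eval_of]
        refine Continuous.mul ?_ ih
        rcases s with i | i
        · exact continuous_apply i
        · exact (continuous_apply i).matrix_transpose
    simpa [eval] using Continuous.fun_const_smul hw a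

/-- Strictly feasible pencils: the strong radical vanishes on the whole positivity domain. -/
theorem strongRealRadical_le_vanishing {g ν ℓ N : ℕ} {L : Matrix (Fin ν) (Fin ν) (NCPoly g)}
    (hL : IsLinearPencil L) (C : Submodule ℝ (Row g ℓ)) {x : Fin g → ℝ}
    (hx : ∀ G ∈ densityMatrices ν, 0 < scalarEval x (contraction L G))
    {X : Fin g → Matrix (Fin N) (Fin N) ℝ} (hX : X ∈ posDomain L N) (v : Fin ℓ → Fin N → ℝ) :
    strongRealRadical L C ⊥ ≤ vanishing X v := by
  intro c hc
  have hcont : Continuous fun t => rowEval (segmentTo X x t) v c := by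
    have hseg : Continuous fun t => segmentTo X x t := by
      unfold segmentTo
      fun_prop
    simp only [rowEval_apply]
    exact continuous_finsetSum _ fun i _ =>
      ((continuous_eval (c i)).comp hseg).matrix_mulVec continuous_const
  -- For `0 < t ≤ 1` the pencil is positive definite on the segment; `t = 0` is reached by closure.
  have hsub : Set.Ioc (0 : ℝ) 1 ⊆ {t | rowEval (segmentTo X x t) v c = 0} := fun t ht =>
    Submodule.mem_sInf.1 hc _ ⟨bot_le,
      isStronglyReal_vanishing v (posDef_segmentTo hL hx hX ht.1 ht.2) hL.1 C⟩
  have h0 := closure_minimal hsub (isClosed_eq hcont continuous_const)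
    (by rw [closure_Ioc zero_ne_one]; exact ⟨le_rfl, zero_le_one⟩ : (0 : ℝ) ∈ _)
  have hseg0 : segmentTo X x 0 = X := by
    ext1 i
    simp [segmentTo]
  rw [mem_vanishing, ← hseg0]
  exact h0

/-! ### The infeasible case and the dimension bounds -/

/-- If no real point is strictly feasible, then strongly real left modules contain `C`. -/
theorem le_of_isStronglyReal {g ν ℓ : ℕ} {L : Matrix (Fin ν) (Fin ν) (NCPoly g)}
    {C : Submodule ℝ (Row g ℓ)} (hC : IsRightChipSpace C) (hfull : IsFull C)
    {G : Matrix (Fin ν) (Fin ν) ℝ} (hG : G ∈ densityMatrices ν) {a : ℝ} (ha : a ≤ 0)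
    (hGa : contraction L G = algebraMap ℝ (NCPoly g) a)
    {J : Submodule (NCPoly g) (Row g ℓ)} (hJ : IsStronglyReal L C J) :
    C ≤ J.restrictScalars ℝ := by
  obtain ⟨⟨S, hS⟩, -⟩ := hC
  have hmem (m : Fin ℓ × NCWord g) (hm : m ∈ S) : monomial m.1 m.2 ∈ C :=
    hS ▸ Submodule.subset_span (Set.mem_image_of_mem _ hm)
  rw [hS, Submodule.span_le]
  rintro _ ⟨⟨i, w⟩, hm, rfl⟩
  have hi : monomial i 1 ∈ C := hfull i w 1 (by rw [mul_one]; exact hmem _ hm)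
  obtain ⟨B, rfl⟩ := posSemidef_iff_exists_gram.1 hG.1
  -- The rows of the Gram factor of `G` turn `∑ q_j^* L q_j` into the contraction, that is `a` at
  -- position `(i, i)`; the single square `p^* p` adds `-a`, so the total is zero.
  let q : Fin ν → Matrix (Fin ν) (Fin ℓ) (NCPoly g) :=
    fun j => Matrix.of fun k => B j k • monomial i 1
  let p : Fin 1 → Row g ℓ := fun _ => √(-a) • monomial i 1
  have hmon (b : ℝ) (j : Fin ℓ) :
      (b • monomial i 1 : Row g ℓ) j = if j = i then algebraMap ℝ (NCPoly g) b else 0 := by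
    rw [Pi.smul_apply, monomial, Pi.single_apply, Algebra.algebraMap_eq_smul_one,
      ← MonoidAlgebra.one_def]
    split_ifs <;> simp
  have hsum : squaresSum L p q = 0 := by
    ext1 j l
    have hq (b : Fin ν) : ((q b)ᴴ * L * q b) j l =
        if j = i ∧ l = i then ∑ k, ∑ l, (B b k * B b l) • L k l else 0 := by
      rw [Matrix.mul_assoc, Matrix.mul_apply]
      simp only [Matrix.mul_apply, conjTranspose_apply, q, Matrix.of_apply, hmon]
      by_cases hj : j = i <;> by_cases hl : l = i <;>
        simp only [hj, hl, star_algebraMap, Finset.mul_sum, ← Algebra.commutes, ← Algebra.smul_def,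
          smul_smul, if_true, if_false, and_true, and_false, star_zero, zero_mul, mul_zero,
          Finset.sum_const_zero]
    have hp : vecMulVec (star (p 0)) (p 0) j l =
        if j = i ∧ l = i then algebraMap ℝ (NCPoly g) (-a) else 0 := by
      rw [vecMulVec_apply, Pi.star_apply]
      simp only [p, hmon]
      by_cases hj : j = i <;> by_cases hl : l = i <;>
        simp only [hj, hl, star_algebraMap, ← map_mul, Real.mul_self_sqrt (neg_nonneg.2 ha),
          if_true, if_false, and_true, and_false, star_zero, zero_mul, mul_zero]
    rw [squaresSum, Matrix.add_apply, Matrix.sum_apply, Matrix.sum_apply, Fin.sum_univ_one, hp,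
      Finset.sum_congr rfl fun b _ => hq b]
    split_ifs
    · have hqq : ∑ b, ∑ k, ∑ l, (B b k * B b l) • L k l = algebraMap ℝ (NCPoly g) a := by
        rw [← hGa, contraction_apply]
        simp only [Matrix.mul_apply, Matrix.transpose_apply, Finset.sum_smul]
        rw [Finset.sum_comm]
        exact Finset.sum_congr rfl fun k _ => Finset.sum_comm
      rw [hqq, ← map_add]
      simp
    · simp
  obtain ⟨-, hq⟩ := hJ 1 ν p q (fun _ => C.smul_mem _ hi) (fun j k => C.smul_mem _ hi)
    (hsum ▸ ⟨0, 0, fun _ => J.zero_mem, fun _ => J.zero_mem, by simp⟩)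
  -- Trace one keeps `B` from being zero, so a nonzero multiple of `e_i ⊗ 1` lies in `J`.
  have hB : ∃ j k, B j k ≠ 0 := by
    by_contra! h0
    have h1 := hG.2
    rw [trace_gram] at h1
    simp [h0] at h1
  obtain ⟨j, k, hjk⟩ := hB
  have hiJ : monomial i 1 ∈ J.restrictScalars ℝ :=
    ((J.restrictScalars ℝ).smul_mem_iff hjk).1 (hq j k)
  have := J.smul_mem (MonoidAlgebra.single w 1) hiJ
  rwa [poly_smul_monomial, mul_one] at this

theorem strongTestSize_eq_zero {g ν ℓ : ℕ} {L : Matrix (Fin ν) (Fin ν) (NCPoly g)}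
    {C : Submodule ℝ (Row g ℓ)} (h : ∀ J, IsStronglyReal L C J → C ≤ J.restrictScalars ℝ) :
    strongTestSize L C = 0 := by
  have hle : C ≤ (strongRealRadical L C ⊥).restrictScalars ℝ := fun c hc =>
    Submodule.mem_sInf.2 fun J hJ => h J hJ.2 hc
  rw [strongTestSize, inf_eq_right.2 hle, Nat.sub_self]

theorem finrank_map_rowEval_le_testSize {g ν ℓ N : ℕ} (C : Submodule ℝ (Row g ℓ))
    [Module.Finite ℝ C] {L : Matrix (Fin ν) (Fin ν) (NCPoly g)} (hL : IsLinearPencil L)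
    {X : Fin g → Matrix (Fin N) (Fin N) ℝ} (hX : X ∈ posDomain L N) (v : Fin ℓ → Fin N → ℝ) :
    Module.finrank ℝ (C.map (rowEval X v)) ≤ testSize L C :=
  finrank_map_rowEval_le C X v (sInf_le ⟨bot_le, isReal_vanishing v hX hL.1 C⟩)

/-- Positivity of n_+ excludes the infeasible alternative, so a strictly feasible point comes for
free. -/
theorem finrank_map_rowEval_le_strongTestSize {g ν ℓ N : ℕ} {C : Submodule ℝ (Row g ℓ)}
    (hC : IsRightChipSpace C) (hfull : IsFull C) [Module.Finite ℝ C]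
    {L : Matrix (Fin ν) (Fin ν) (NCPoly g)} (hL : IsLinearPencil L) (hpos : 0 < strongTestSize L C)
    {X : Fin g → Matrix (Fin N) (Fin N) ℝ} (hX : X ∈ posDomain L N) (v : Fin ℓ → Fin N → ℝ) :
    Module.finrank ℝ (C.map (rowEval X v)) ≤ strongTestSize L C := by
  rcases exists_contraction_or_exists_pos hL with ⟨G, hG, a, ha, hGa⟩ | ⟨x, hx⟩
  · exact absurd (strongTestSize_eq_zero fun J hJ =>
      le_of_isStronglyReal hC hfull hG ha hGa hJ) hpos.ne'
  · exact finrank_map_rowEval_le C X v (strongRealRadical_le_vanishing hL C hx hX v)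

end FreePencil

end

theorem corollary4 {g ν ℓ : ℕ} (C : Submodule ℝ (FreePencil.Row g ℓ))
    (hC : FreePencil.IsRightChipSpace C) (hfull : FreePencil.IsFull C)
    (hfin : Module.Finite ℝ C)
    (L : Matrix (Fin ν) (Fin ν) (FreePencil.NCPoly g)) (hL : FreePencil.IsLinearPencil L)
    (p : Matrix (Fin ℓ) (Fin ℓ) (FreePencil.NCPoly g))
    (hp : p ∈ FreePencil.chipProducts C) (hsymm : p.IsHermitian) :
    (0 < FreePencil.strongTestSize L C →
      ((∀ N, FreePencil.PosOn p L N) ↔ FreePencil.PosOn p L (FreePencil.strongTestSize L C))) ∧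
    (0 < FreePencil.testSize L C →
      ((∀ N, FreePencil.PosOn p L N) ↔ FreePencil.PosOn p L (FreePencil.testSize L C))) ∧
    ((∀ N, FreePencil.NonnegOn p L N) ↔ FreePencil.NonnegOn p L (FreePencil.testSize L C)) := by
  refine ⟨fun hn => ⟨fun h => h _, fun h N => ?_⟩, fun hn => ⟨fun h => h _, fun h N => ?_⟩,
    fun h => h _, fun h N => ?_⟩
  · exact FreePencil.posOn_of_finrank_le hC hfull hL hp hsymm (fun X hX v =>
      FreePencil.finrank_map_rowEval_le_strongTestSize hC hfull hL hn hX v) hn h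
  · exact FreePencil.posOn_of_finrank_le hC hfull hL hp hsymm (fun X hX v =>
      FreePencil.finrank_map_rowEval_le_testSize C hL hX v) hn h
  · exact FreePencil.nonnegOn_of_finrank_le hC hfull hL hp hsymm (fun X hX v =>
      FreePencil.finrank_map_rowEval_le_testSize C hL hX v) h
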